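/- Let $\mathbb{F}_q$ be a finite field with $q$ elements, $q\geq 13$. Every function $f:\mathbb{F}_q^2\to\mathbb{F}_q$ is given by a unique polynomial of degree at most $q-1$ in each of the two variables (its reduced form); the degree of $f$ is the total degree of this polynomial. Let $R_q(5,2)$ be the set of functions $f:\mathbb{F}_q^2\to\mathbb{F}_q$ of degree at most $5$, and let the weight $|f|$ be the number of points at which $f$ is nonzero. Then the third weight of $R_q(5,2)$, that is, the third smallest element of $\{|f| : f\in R_q(5,2),\ f\neq 0\}$, is $(q-3)(q-2)$. Furthermore, a function $f:\mathbb{F}_q^2\to\mathbb{F}_q$ belongs to $R_q(5,2)$ and satisfies $|f|=(q-3)(q-2)$ if and only if there is an invertible affine transformation $T$ of $\mathbb{F}_q^2$ such that $g=f\circ T$ has, for all $(x,y)\in\mathbb{F}_q^2$, one of the following four forms: 1. $g(x,y)=\Big(\prod_{i=1}^{3}(x-b_i)\Big)(y-c)(y-d)$, where $b_1,b_2,b_3\in\mathbb{F}_q$ are pairwise distinct, $c,d\in\mathbb{F}_q$ and $c\neq d$; 2. $g(x,y)=\Big(\prod_{i=1}^{4}(a_ix+b_iy)\Big)(a_1x+b_1y+e)$,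 where $(a_i,b_i)\in\mathbb{F}_q^2\setminus\{(0,0)\}$, $a_ib_j-a_jb_i\neq 0$ for $i\neq j$, and $e\in\mathbb{F}_q^*$; 3. $g(x,y)=\Big(\prod_{i=1}^{3}(a_ix+b_iy)\Big)\prod_{j=1}^{2}(a_1x+b_1y+e_j)$, where $(a_i,b_i)\in\mathbb{F}_q^2\setminus\{(0,0)\}$, $a_ib_j-a_jb_i\neq 0$ for $i\neq j$, $e_1,e_2\in\mathbb{F}_q^*$ and $e_1\neq e_2$; 4. $g(x,y)=\lambda\,(x-a)(x-b)(y-c)(y-d)\big((d-c)x+(a-b)y+bc-ad\big)$, where $\lambda\in\mathbb{F}_q^*$, $a,b,c,d\in\mathbb{F}_q$, $a\neq b$ and $c\neq d$. -/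

import Mathlib

open scoped BigOperators

namespace ReedMuller

/-- Every function `F^m → F` is given by exactly one polynomial of degree at most `q - 1` in
each variable. -/
theorem existsUnique_reducedForm {F : Type*} [Field F] [Fintype F] {m : ℕ}
    (f : (Fin m → F) → F) :
    ∃! P : MvPolynomial (Fin m) F,
      P ∈ MvPolynomial.restrictDegree (Fin m) F (Fintype.card F - 1) ∧
        ∀ x, MvPolynomial.eval x P = f x := by
  have hf : f ∈ (MvPolynomial.restrictDegree (Fin m) F (Fintype.card F - 1)).map
      (MvPolynomial.evalₗ F (Fin m)) := by
    rw [MvPolynomial.map_restrict_dom_evalₗ]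
    trivial
  obtain ⟨P, hP, hPf⟩ := hf
  have hPf' : ∀ x, MvPolynomial.eval x P = f x := fun x => congrFun hPf x
  refine ⟨P, ⟨hP, hPf'⟩, ?_⟩
  rintro Q ⟨hQ, hQf⟩
  have hsub := Submodule.sub_mem _ hQ hP
  rw [MvPolynomial.mem_restrictDegree] at hsub
  have hpos : 0 < Fintype.card F := Fintype.card_pos
  refine sub_eq_zero.mp (MvPolynomial.eq_zero_of_eval_zero_at_prod_finset (Q - P)
    (fun _ => Finset.univ) (fun i => ?_) (fun x _ => ?_))
  · rw [Finset.card_univ, MvPolynomial.degreeOf_lt_iff hpos]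
    intro s hs
    have := hsub s hs i
    omega
  · rw [map_sub, hQf, hPf', sub_self]

/-- The reduced form of a function `f : F^m → F`. -/
noncomputable def reducedForm {F : Type*} [Field F] [Fintype F] {m : ℕ}
    (f : (Fin m → F) → F) : MvPolynomial (Fin m) F :=
  (existsUnique_reducedForm f).choose

/-- The degree of a function is the total degree of its reduced form. -/
noncomputable def degree {F : Type*} [Field F] [Fintype F] {m : ℕ}
    (f : (Fin m → F) → F) : ℕ :=
  (reducedForm f).totalDegree

/-- The generalized Reed-Muller code `R_q(r, m)` over the field `F` with `q` elements. -/
def code (F : Type*) [Field F] [Fintype F] (r m : ℕ) : Set ((Fin m → F) → F) :=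
  {f | degree f ≤ r}

/-- The (Hamming) weight of `f`: the cardinality of its support. -/
noncomputable def weight {F : Type*} [Field F] {m : ℕ} (f : (Fin m → F) → F) : ℕ :=
  (Function.support f).ncard

/-- The set of weights of the nonzero words of `C`. -/
def weights {F : Type*} [Field F] {m : ℕ} (C : Set ((Fin m → F) → F)) : Set ℕ :=
  {w | ∃ f ∈ C, f ≠ 0 ∧ weight f = w}

/-- `w` is the third smallest weight of `C`: it is the weight of a nonzero word of `C`, and
exactly two weights of nonzero words of `C` are smaller than `w`. -/
def IsThirdWeight {F : Type*} [Field F] {m : ℕ} (C : Set ((Fin m → F) → F)) (w : ℕ) : Prop :=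
  w ∈ weights C ∧ {v | v ∈ weights C ∧ v < w}.ncard = 2

/-- Products of three distinct lines parallel to the `y`-axis and two distinct lines parallel
to the `x`-axis. -/
def IsGridWord {F : Type*} [Field F] (g : (Fin 2 → F) → F) : Prop :=
  ∃ (b : Fin 3 → F) (c d : F), (∀ i j, i ≠ j → b i ≠ b j) ∧ c ≠ d ∧
    ∀ x y : F, g ![x, y] = (∏ i, (x - b i)) * ((y - c) * (y - d))

/-- Products of four distinct lines through the origin and a line parallel to one of them. -/
def IsPencilWord {F : Type*} [Field F] (g : (Fin 2 → F) → F) : Prop :=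
  ∃ (a b : Fin 4 → F) (e : F), (∀ i, (a i, b i) ≠ (0, 0)) ∧
    (∀ i j, i ≠ j → a i * b j - a j * b i ≠ 0) ∧ e ≠ 0 ∧
    ∀ x y : F, g ![x, y] = (∏ i, (a i * x + b i * y)) * (a 0 * x + b 0 * y + e)

/-- Products of three distinct lines through the origin and two further distinct lines, both
parallel to the same one of them. -/
def IsTripleParallelWord {F : Type*} [Field F] (g : (Fin 2 → F) → F) : Prop :=
  ∃ (a b : Fin 3 → F) (e : Fin 2 → F), (∀ i, (a i, b i) ≠ (0, 0)) ∧
    (∀ i j, i ≠ j → a i * b j - a j * b i ≠ 0) ∧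
    (∀ j, e j ≠ 0) ∧ (∀ i j, i ≠ j → e i ≠ e j) ∧
    ∀ x y : F, g ![x, y] =
      (∏ i, (a i * x + b i * y)) * ∏ j, (a 0 * x + b 0 * y + e j)

/-- Nonzero multiples of the products of the four side lines of a parallelogram with sides
parallel to the axes and one of its diagonals. -/
def IsDiagonalWord {F : Type*} [Field F] (g : (Fin 2 → F) → F) : Prop :=
  ∃ l a b c d : F, l ≠ 0 ∧ a ≠ b ∧ c ≠ d ∧
    ∀ x y : F, g ![x, y] =
      l * ((x - a) * (x - b) * (y - c) * (y - d) *
        ((d - c) * x + (a - b) * y + b * c - a * d))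

end ReedMuller

/-! A word of weight at most `(q - 3) (q - 2)` has at least `5 q - 6` zeros. Counting zeros on the
`q + 1` lines through one zero (`card_zeros_le`) shows that a polynomial of degree at most 5 with so
many zeros vanishes on some line. The linear form can be divided out at the cost of at most `q`
zeros, and induction makes the word a constant times a product of five lines, distinct because four
lines cover too little (`exists_eq_lineProd_of_card_zeros`).

An affine change of coordinates makes a largest parallel class vertical: `r` lines `x = ρ`, `ρ ∈ R`,
and `s = 5 - r` lines `M` with slopes. Counting column by column, the weight is at least `(q - r) (q
- s)`, with equality exactly when no two lines of `M` meet off the columns in `R`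
(`weight_lineProd_of_injOn`, `injOn_of_weight_lineProd_le`). For `r = 5` the weight is `q² - 5q`,
for `r = 4` it is `q² - 5q + 4`. For `r = 1` the slopes are distinct, and the weight is `q² - 5q +
4` or at least `q² - 5q + 7` (`four_slopes`). For `r = 2, 3` the lower bound is `q² - 5q + 6 = (q -
3) (q - 2)`, and equality leaves the four listed configurations. Conversely, each listed form
becomes such a product of lines after a change of coordinates, which gives its degree and weight. -/

namespace ReedMuller

open MvPolynomial

/-! ### Restriction to lines and linear factors. -/

section Polynomials

variable {F : Type*} [Field F]

/-- Two polynomial maps agreeing on the variables modulo `l` agree modulo `l`. -/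
theorem dvd_sub_of_dvd_sub_X {σ : Type*} {l : MvPolynomial σ F}
    (φ : MvPolynomial σ F →ₐ[F] MvPolynomial σ F) (h : ∀ i, l ∣ X i - φ (X i))
    (P : MvPolynomial σ F) : l ∣ P - φ P := by
  induction P using MvPolynomial.induction_on with
  | C a => simp [← MvPolynomial.algebraMap_eq]
  | add p q hp hq =>
    rw [map_add, add_sub_add_comm]
    exact dvd_add hp hq
  | mul_X p i hp =>
    have : p * X i - φ (p * X i) = (p - φ p) * X i + φ p * (X i - φ (X i)) := by
      rw [map_mul]; ring
    rw [this]
    exact dvd_add (hp.mul_right _) ((h i).mul_left _)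

/-- The restriction of a bivariate polynomial to a parametrized curve. -/
noncomputable def restrict (u v : Polynomial F) (P : MvPolynomial (Fin 2) F) : Polynomial F :=
  MvPolynomial.aeval ![u, v] P

theorem eval_restrict (u v : Polynomial F) (P : MvPolynomial (Fin 2) F) (t : F) :
    (restrict u v P).eval t = MvPolynomial.eval ![u.eval t, v.eval t] P := by
  unfold restrict
  induction P using MvPolynomial.induction_on with
  | C a => simp
  | add p q hp hq => simp [hp, hq]
  | mul_X p i hp =>
    simp only [map_mul, Polynomial.eval_mul, hp, aeval_X, eval_X]
    fin_cases i <;> simp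

theorem natDegree_restrict_le {u v : Polynomial F} (hu : u.natDegree ≤ 1) (hv : v.natDegree ≤ 1)
    {P : MvPolynomial (Fin 2) F} {d : ℕ} (hP : P.totalDegree ≤ d) :
    (restrict u v P).natDegree ≤ d := by
  have := MvPolynomial.aeval_natDegree_le P hP ![u, v] (n := 1) (fun i => by
    fin_cases i <;> simpa)
  simpa [restrict] using this

theorem restrict_eq_zero [Fintype F] {u v : Polynomial F} (hu : u.natDegree ≤ 1)
    (hv : v.natDegree ≤ 1) {P : MvPolynomial (Fin 2) F}
    (hP : P.totalDegree < Fintype.card F)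
    (h : ∀ t, MvPolynomial.eval ![u.eval t, v.eval t] P = 0) : restrict u v P = 0 := by
  refine Polynomial.eq_zero_of_natDegree_lt_card_of_eval_eq_zero' _ Finset.univ
    (fun t _ => by rw [eval_restrict, h]) ?_
  exact (natDegree_restrict_le hu hv le_rfl).trans_lt (by simpa using hP)

/-- Since the degree is below `q`, the restriction to the line is the zero polynomial, not just the
zero function. Substituting `x = r` changes `P` only by a multiple of `x - r`. -/
theorem vertical_dvd [Fintype F] {P : MvPolynomial (Fin 2) F}
    (hP : P.totalDegree < Fintype.card F) (r : F) (h : ∀ y, MvPolynomial.eval ![r, y] P = 0) :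
    X 0 - C r ∣ P := by
  have h0 : restrict (Polynomial.C r) Polynomial.X P = 0 :=
    restrict_eq_zero (by simp) (by simp) hP (by simpa using h)
  have := dvd_sub_of_dvd_sub_X (l := X 0 - C r)
    ((Polynomial.aeval (X 1 : MvPolynomial (Fin 2) F)).comp
      (MvPolynomial.aeval ![Polynomial.C r, Polynomial.X])) (fun i => by
        fin_cases i <;> simp [MvPolynomial.algebraMap_eq]) P
  rw [AlgHom.comp_apply] at this
  change _ ∣ P - Polynomial.aeval _ (restrict _ _ P) at this
  simpa [h0] using this

theorem slanted_dvd [Fintype F] {P : MvPolynomial (Fin 2) F}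
    (hP : P.totalDegree < Fintype.card F) (m c : F)
    (h : ∀ x, MvPolynomial.eval ![x, m * x + c] P = 0) :
    X 1 - C m * X 0 - C c ∣ P := by
  have hd : (Polynomial.C m * Polynomial.X + Polynomial.C c).natDegree ≤ 1 := by
    compute_degree
  have h0 : restrict Polynomial.X (Polynomial.C m * Polynomial.X + Polynomial.C c) P = 0 :=
    restrict_eq_zero (by simp) hd hP (by simpa using h)
  have := dvd_sub_of_dvd_sub_X (l := X 1 - C m * X 0 - C c)
    ((Polynomial.aeval (X 0 : MvPolynomial (Fin 2) F)).comp
      (MvPolynomial.aeval ![Polynomial.X, Polynomial.C m * Polynomial.X + Polynomial.C c]))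
      (fun i => by
        fin_cases i
        · simp
        · simp [MvPolynomial.algebraMap_eq, sub_sub]) P
  rw [AlgHom.comp_apply] at this
  change _ ∣ P - Polynomial.aeval _ (restrict _ _ P) at this
  simpa [h0] using this

/-- The points `z` and `w` only certify that `l` is not constant, so that it contributes at least 1
to the degree of the product. -/
theorem totalDegree_le_of_mul {σ : Type*} {l Q : MvPolynomial σ F} (z w : σ → F)
    (hl : MvPolynomial.eval z l ≠ MvPolynomial.eval w l) (hQ : Q ≠ 0) {d : ℕ}
    (h : (l * Q).totalDegree ≤ d + 1) : Q.totalDegree ≤ d := by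
  have hl0 : l ≠ 0 := by rintro rfl; simp at hl
  have hl1 : l.totalDegree ≠ 0 := by
    intro h0
    rw [MvPolynomial.totalDegree_eq_zero_iff_eq_C] at h0
    rw [h0] at hl
    simp at hl
  rw [MvPolynomial.totalDegree_mul_of_isDomain hl0 hQ] at h
  omega

end Polynomials

/-! ### Zeros counted along a pencil of lines. -/

section Counting

variable {F : Type*} [Field F] [Fintype F] [DecidableEq F]

/-- The zeros of a function on the plane. -/
def zeros (f : (Fin 2 → F) → F) : Finset (F × F) := {p | f ![p.1, p.2] = 0}

@[simp] theorem mem_zeros {f : (Fin 2 → F) → F} {p : F × F} :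
    p ∈ zeros f ↔ f ![p.1, p.2] = 0 := by simp [zeros]

/-- A polynomial of degree at most `d + 1` vanishing on no line has at most `1 + (q + 1) d`
zeros. -/
theorem card_zeros_le {P : MvPolynomial (Fin 2) F} {d : ℕ} (hP : P.totalDegree ≤ d + 1)
    (hv : ∀ r, ∃ y, MvPolynomial.eval ![r, y] P ≠ 0)
    (hs : ∀ m c, ∃ x, MvPolynomial.eval ![x, m * x + c] P ≠ 0) :
    (zeros fun z => MvPolynomial.eval z P).card ≤ 1 + (Fintype.card F + 1) * d := by
  set Z := zeros fun z => MvPolynomial.eval z P with hZ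
  rcases Z.eq_empty_or_nonempty with h | ⟨⟨x₀, y₀⟩, h₀⟩
  · simp [h]
  have h₀' := mem_zeros.1 h₀
  -- On a line through the chosen zero the restriction is nonzero of degree at most `d + 1`; one
  -- root is `t₀`, so at most `d` others remain.
  have key : ∀ u v : Polynomial F, u.natDegree ≤ 1 → v.natDegree ≤ 1 →
      (∃ t, MvPolynomial.eval ![u.eval t, v.eval t] P ≠ 0) → ∀ t₀,
      MvPolynomial.eval ![u.eval t₀, v.eval t₀] P = 0 → ∀ (A : Finset (F × F)) (w : F × F → F),
      Set.InjOn w A → (∀ p ∈ A, w p ≠ t₀ ∧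
        MvPolynomial.eval ![u.eval (w p), v.eval (w p)] P = 0) → A.card ≤ d := by
    rintro u v hu hv ⟨t, ht⟩ t₀ ht₀ A w hw hA
    have hne : restrict u v P ≠ 0 := by
      intro h; apply ht; rw [← eval_restrict, h]; simp
    have h1 : (restrict u v P).roots.toFinset.card ≤ d + 1 :=
      (Multiset.toFinset_card_le _).trans
        ((Polynomial.card_roots' _).trans (natDegree_restrict_le hu hv hP))
    have h2 : t₀ ∈ (restrict u v P).roots.toFinset := by
      simp [hne, eval_restrict, ht₀]
    have h3 : A.card ≤ ((restrict u v P).roots.toFinset.erase t₀).card := by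
      refine Finset.card_le_card_of_injOn w (fun p hp => ?_) hw
      have := hA p hp
      simp [hne, eval_restrict, this]
    rw [Finset.card_erase_of_mem h2] at h3
    omega
  -- The remaining zeros are sorted by the slope of their line to `(x₀, y₀)`; `none` is the vertical
  -- direction.
  have hcard : (Z.erase (x₀, y₀)).card ≤ d * (Finset.univ : Finset (Option F)).card := by
    refine Finset.card_le_mul_card_image_of_maps_to
      (f := fun p => if p.1 = x₀ then none else some ((p.2 - y₀) / (p.1 - x₀)))
      (fun _ _ => Finset.mem_univ _) d (fun o _ => ?_)
    cases o with
    | none =>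
      refine key (Polynomial.C x₀) Polynomial.X (by simp) (by simp) (by simpa using hv x₀) y₀
        (by simpa using h₀') _ Prod.snd ?_ ?_
      · rintro ⟨a, b⟩ h ⟨a', b'⟩ h' hb
        simp_all
      · rintro ⟨a, b⟩ h
        simp only [Finset.mem_filter, Finset.mem_erase, ne_eq, Prod.mk.injEq, hZ, mem_zeros,
          ite_eq_left_iff, reduceCtorEq, imp_false, not_not] at h
        obtain ⟨⟨h1, h2⟩, rfl⟩ := h
        simpa using ⟨fun h => h1 ⟨rfl, h⟩, h2⟩
    | some m =>
      have hline : ∀ p : F × F, p ∈ Z.erase (x₀, y₀) →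
          (if p.1 = x₀ then none else some ((p.2 - y₀) / (p.1 - x₀))) = some m →
          p.1 ≠ x₀ ∧ p.2 = m * p.1 + (y₀ - m * x₀) ∧
            MvPolynomial.eval ![p.1, p.2] P = 0 := by
        intro p hp h
        rw [Finset.mem_erase, hZ, mem_zeros] at hp
        split_ifs at h with h1
        have h1' : p.1 - x₀ ≠ 0 := sub_ne_zero.2 h1
        rw [Option.some_inj, div_eq_iff h1'] at h
        exact ⟨h1, by linear_combination h, hp.2⟩
      have hd : (Polynomial.C m * Polynomial.X + Polynomial.C (y₀ - m * x₀)).natDegree ≤ 1 := by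
        compute_degree
      refine key Polynomial.X (Polynomial.C m * Polynomial.X + Polynomial.C (y₀ - m * x₀))
        (by simp) hd (by simpa using hs m (y₀ - m * x₀)) x₀
        (by simpa using h₀') _ Prod.fst ?_ ?_
      · rintro p h p' h' hb
        rw [Finset.mem_coe, Finset.mem_filter] at h h'
        have e := hline p h.1 h.2
        have e' := hline p' h'.1 h'.2
        refine Prod.ext hb ?_
        rw [e.2.1, e'.2.1, hb]
      · rintro p h
        rw [Finset.mem_filter] at h
        have e := hline p h.1 h.2
        refine ⟨e.1, ?_⟩
        have := e.2.2
        rw [e.2.1] at this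
        simpa using this
  rw [Finset.card_erase_of_mem h₀, Finset.card_univ, Fintype.card_option, mul_comm] at hcard
  omega

end Counting

/-! ### Products of lines. -/

section LineProd

variable {F : Type*} [Field F]

/-- The product of the lines `x = r`, `r ∈ R`, and `y = m x + c`, `(m, c) ∈ M`, with leading
coefficient `k`. -/
def lineProd (k : F) (R : Finset F) (M : Finset (F × F)) (z : Fin 2 → F) : F :=
  k * ((∏ r ∈ R, (z 0 - r)) * ∏ p ∈ M, (z 1 - p.1 * z 0 - p.2))

theorem lineProd_eq_zero [DecidableEq F] {k : F} (hk : k ≠ 0) {R : Finset F}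
    {M : Finset (F × F)} {x y : F} :
    lineProd k R M ![x, y] = 0 ↔ x ∈ R ∨ y ∈ M.image fun p => p.1 * x + p.2 := by
  simp only [lineProd, mul_eq_zero, hk, false_or, Finset.prod_eq_zero_iff, Finset.mem_image,
    Matrix.cons_val_zero, Matrix.cons_val_one, sub_sub, sub_eq_zero]
  simp [eq_comm]

end LineProd

/-! ### Words with many zeros are products of lines. -/

section Factorization

variable {F : Type*} [Field F] [Fintype F] [DecidableEq F]

theorem card_zeros_mul_le (f g h : (Fin 2 → F) → F)
    (hfgh : ∀ x y, f ![x, y] = g ![x, y] * h ![x, y]) :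
    (zeros f).card ≤ (zeros g).card + (zeros h).card := by
  refine (Finset.card_le_card (t := zeros g ∪ zeros h) ?_).trans (Finset.card_union_le _ _)
  intro p
  simp [hfgh]

theorem card_zeros_vertical_le (r : F) :
    (zeros fun z => z 0 - r).card ≤ Fintype.card F := by
  refine Finset.card_le_card_of_injOn Prod.snd (fun _ _ => Finset.mem_univ _) ?_
  rintro ⟨a, b⟩ h ⟨a', b'⟩ h' hb
  simp [sub_eq_zero] at h h' hb
  simp [*]

theorem card_zeros_slanted_le (m c : F) :
    (zeros fun z => z 1 - m * z 0 - c).card ≤ Fintype.card F := by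
  refine Finset.card_le_card_of_injOn Prod.fst (fun _ _ => Finset.mem_univ _) ?_
  rintro ⟨a, b⟩ h ⟨a', b'⟩ h' hb
  simp only [Finset.mem_coe, mem_zeros, Matrix.cons_val_one, Matrix.cons_val_zero] at h h' hb
  subst hb
  exact Prod.ext rfl (by linear_combination h - h')

/-- A polynomial of degree at most `d ≤ 5` with at least `d q - 6` zeros is a product of
lines. -/
theorem exists_lines_of_card_zeros (hq : 13 ≤ Fintype.card F) (d : ℕ) (hd : d ≤ 5)
    (P : MvPolynomial (Fin 2) F) (hP : P ≠ 0) (hdeg : P.totalDegree ≤ d)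
    (hz : d * Fintype.card F ≤ (zeros fun z => MvPolynomial.eval z P).card + 6) :
    ∃ (k : F) (R : Multiset F) (M : Multiset (F × F)), k ≠ 0 ∧ R.card + M.card = d ∧
      ∀ x y, MvPolynomial.eval ![x, y] P =
        k * ((R.map fun r => x - r).prod * (M.map fun p => y - p.1 * x - p.2).prod) := by
  induction d generalizing P with
  | zero =>
    have := (MvPolynomial.totalDegree_eq_zero_iff_eq_C).1 (Nat.le_zero.1 hdeg)
    refine ⟨P.coeff 0, 0, 0, ?_, rfl, fun x y => ?_⟩
    · intro h; rw [h] at this; simp [this] at hP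
    · conv_lhs => rw [this]
      simp
  | succ d ih =>
    have hcase : (∃ r, ∀ y, MvPolynomial.eval ![r, y] P = 0) ∨
        ∃ m c, ∀ x, MvPolynomial.eval ![x, m * x + c] P = 0 := by
      by_contra! h
      -- Without a line of zeros, `(d + 1) q - 6 ≤ 1 + (q + 1) d`, hence `q ≤ d + 7 ≤ 11`.
      have := card_zeros_le hdeg h.1 h.2
      nlinarith
    rcases hcase with ⟨r, hr⟩ | ⟨m, c, hm⟩
    · obtain ⟨Q, rfl⟩ := vertical_dvd (by omega) r hr
      have hQ : Q ≠ 0 := right_ne_zero_of_mul hP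
      have h1 := card_zeros_mul_le (fun z => MvPolynomial.eval z ((X 0 - C r) * Q))
        (fun z => z 0 - r) (fun z => MvPolynomial.eval z Q) (by simp)
      have h2 := card_zeros_vertical_le r
      obtain ⟨k, R, M, hk, hRM, he⟩ := ih (by omega) Q hQ
        (totalDegree_le_of_mul ![r, 0] ![r + 1, 0] (by simp) hQ hdeg)
        (by rw [add_mul] at hz; omega)
      refine ⟨k, r ::ₘ R, M, hk, by simp; omega, fun x y => ?_⟩
      simp [he]
      ring
    · obtain ⟨Q, rfl⟩ := slanted_dvd (by omega) m c hm
      have hQ : Q ≠ 0 := right_ne_zero_of_mul hP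
      have h1 := card_zeros_mul_le
        (fun z => MvPolynomial.eval z ((X 1 - C m * X 0 - C c) * Q))
        (fun z => z 1 - m * z 0 - c) (fun z => MvPolynomial.eval z Q) (by simp)
      have h2 := card_zeros_slanted_le m c
      obtain ⟨k, R, M, hk, hRM, he⟩ := ih (by omega) Q hQ
        (totalDegree_le_of_mul ![0, c] ![0, c + 1] (by simp) hQ hdeg)
        (by rw [add_mul] at hz; omega)
      refine ⟨k, R, (m, c) ::ₘ M, hk, by simp; omega, fun x y => ?_⟩
      simp [he]
      ring

/-- The five lines are distinct: four lines cover at most `4 q < 5 q - 6` points. This turns the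
multisets into finsets. -/
theorem exists_eq_lineProd_of_card_zeros (hq : 13 ≤ Fintype.card F)
    (P : MvPolynomial (Fin 2) F) (hP : P ≠ 0) (hdeg : P.totalDegree ≤ 5)
    (hz : 5 * Fintype.card F ≤ (zeros fun z => MvPolynomial.eval z P).card + 6) :
    ∃ (k : F) (R : Finset F) (M : Finset (F × F)), k ≠ 0 ∧ R.card + M.card = 5 ∧
      ∀ x y, MvPolynomial.eval ![x, y] P = lineProd k R M ![x, y] := by
  obtain ⟨k, R, M, hk, hRM, he⟩ := exists_lines_of_card_zeros hq 5 le_rfl P hP hdeg hz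
  have hsub : (zeros fun z => MvPolynomial.eval z P) ⊆
      (R.toFinset.biUnion fun r => zeros fun z => z 0 - r) ∪
        M.toFinset.biUnion fun p => zeros fun z => z 1 - p.1 * z 0 - p.2 := by
    rintro ⟨x, y⟩
    simp [he, hk, Multiset.prod_eq_zero_iff]
  have hle := (Finset.card_le_card hsub).trans (Finset.card_union_le _ _)
  have h1 := Finset.card_biUnion_le_card_mul R.toFinset (fun r => zeros fun z => z 0 - r) _
    fun r _ => card_zeros_vertical_le r
  have h2 := Finset.card_biUnion_le_card_mul M.toFinset
    (fun p => zeros fun z => z 1 - p.1 * z 0 - p.2) _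
    fun p _ => card_zeros_slanted_le p.1 p.2
  have h3 := R.toFinset_card_le
  have h4 := M.toFinset_card_le
  have h5 : 5 ≤ R.toFinset.card + M.toFinset.card := by
    by_contra! h
    have : R.toFinset.card + M.toFinset.card ≤ 4 := by omega
    nlinarith
  have hR : R.Nodup := Multiset.toFinset_card_eq_card_iff_nodup.1 (by omega)
  have hM : M.Nodup := Multiset.toFinset_card_eq_card_iff_nodup.1 (by omega)
  exact ⟨k, ⟨R, hR⟩, ⟨M, hM⟩, hk, hRM, fun x y => he x y⟩

end Factorization

/-! ### Affine invariance of the code and of the weight. -/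

section Code

variable {F : Type*} [Field F]

/-- A polynomial of total degree below `q` is already reduced, so any representing polynomial of
degree at most `r` will do. -/
theorem mem_code_iff [Fintype F] {r m : ℕ} (hr : r < Fintype.card F) {f : (Fin m → F) → F} :
    f ∈ code F r m ↔
      ∃ P : MvPolynomial (Fin m) F, P.totalDegree ≤ r ∧ ∀ z, MvPolynomial.eval z P = f z := by
  have hspec := (existsUnique_reducedForm f).choose_spec
  constructor
  · intro h
    exact ⟨reducedForm f, h, hspec.1.2⟩
  · rintro ⟨P, hP, he⟩
    have : P = reducedForm f := by
      refine hspec.2 P ⟨?_, he⟩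
      rw [MvPolynomial.mem_restrictDegree]
      intro s hs i
      have h1 := MvPolynomial.le_totalDegree hs
      have h2 : s i ≤ s.sum fun _ e => e := by
        by_cases h : i ∈ s.support
        · exact Finset.single_le_sum (f := fun i => s i) (fun _ _ => Nat.zero_le _) h
        · simp [Finsupp.notMem_support_iff.1 h]
      omega
    rw [this] at hP
    exact hP

theorem totalDegree_aeval_le {σ : Type*} (P : MvPolynomial σ F) (u : σ → MvPolynomial σ F)
    (hu : ∀ i, (u i).totalDegree ≤ 1) : (MvPolynomial.aeval u P).totalDegree ≤ P.totalDegree := by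
  rw [MvPolynomial.aeval_def, MvPolynomial.eval₂_eq]
  refine MvPolynomial.totalDegree_finsetSum_le fun s hs => ?_
  refine (MvPolynomial.totalDegree_mul _ _).trans ?_
  rw [MvPolynomial.algebraMap_eq, MvPolynomial.totalDegree_C, zero_add]
  refine (MvPolynomial.totalDegree_finsetProd _ _).trans ?_
  refine le_trans (Finset.sum_le_sum (g := fun i => s i) fun i _ => ?_)
    (MvPolynomial.le_totalDegree hs)
  exact (MvPolynomial.totalDegree_pow _ _).trans
    ((Nat.mul_le_mul_left _ (hu i)).trans (mul_one _).le)

theorem affine_apply (T : (Fin 2 → F) ≃ᵃ[F] (Fin 2 → F)) (z : Fin 2 → F) (i : Fin 2) :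
    T z i = T.linear ![1, 0] i * z 0 + T.linear ![0, 1] i * z 1 + T 0 i := by
  have h1 : T z = T.linear z + T 0 := by
    have := T.map_vadd 0 z
    simpa using this
  have h2 : z = z 0 • ![1, 0] + z 1 • ![0, 1] := by
    ext j; fin_cases j <;> simp
  rw [h1]
  conv_lhs => rw [h2]
  rw [map_add, map_smul, map_smul]
  simp [mul_comm]

theorem comp_mem_code [Fintype F] {r : ℕ} (hr : r < Fintype.card F) {f : (Fin 2 → F) → F}
    (hf : f ∈ code F r 2) (T : (Fin 2 → F) ≃ᵃ[F] (Fin 2 → F)) : f ∘ T ∈ code F r 2 := by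
  rw [mem_code_iff hr] at hf ⊢
  obtain ⟨P, hP, he⟩ := hf
  let u : Fin 2 → MvPolynomial (Fin 2) F := fun i =>
    C (T.linear ![1, 0] i) * X 0 + C (T.linear ![0, 1] i) * X 1 + C (T 0 i)
  refine ⟨MvPolynomial.aeval u P, (totalDegree_aeval_le P u fun i => ?_).trans hP, fun z => ?_⟩
  · have h (a : F) (j : Fin 2) : (C a * X j : MvPolynomial (Fin 2) F).totalDegree ≤ 1 :=
      (MvPolynomial.totalDegree_mul _ _).trans (by simp)
    exact (MvPolynomial.totalDegree_add _ _).trans (max_le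
      ((MvPolynomial.totalDegree_add _ _).trans (max_le (h _ _) (h _ _))) (by simp))
  · have hu : T z = fun i => MvPolynomial.eval z (u i) := by
      ext i
      rw [affine_apply]
      simp [u]
    rw [Function.comp_apply, ← he, hu]
    rw [MvPolynomial.aeval_def, MvPolynomial.algebraMap_eq]
    rw [MvPolynomial.eval_eval₂]
    congr 1
    ext a
    simp

theorem comp_mem_code_iff [Fintype F] {r : ℕ} (hr : r < Fintype.card F) {f : (Fin 2 → F) → F}
    (T : (Fin 2 → F) ≃ᵃ[F] (Fin 2 → F)) : f ∘ T ∈ code F r 2 ↔ f ∈ code F r 2 := by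
  refine ⟨fun h => ?_, fun h => comp_mem_code hr h T⟩
  have := comp_mem_code hr h T.symm
  convert this using 1
  ext z; simp

theorem weight_comp (f : (Fin 2 → F) → F) (T : (Fin 2 → F) ≃ᵃ[F] (Fin 2 → F)) :
    weight (f ∘ T) = weight f := by
  unfold weight
  rw [Function.support_comp_eq_preimage]
  exact Set.ncard_preimage_of_injective_subset_range T.injective (by simp [T.surjective.range_eq])

theorem weight_add_card_zeros [Fintype F] [DecidableEq F] (f : (Fin 2 → F) → F) :
    weight f + (zeros f).card = Fintype.card F * Fintype.card F := by
  have h : weight f = (Finset.univ.filter fun p : F × F => ¬ f ![p.1, p.2] = 0).card := by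
    unfold weight
    rw [← Set.ncard_coe_finset]
    rw [← Set.ncard_image_of_injective _ (finTwoArrowEquiv F).injective]
    congr 1
    ext ⟨a, b⟩
    simp only [Set.mem_image, Function.mem_support, Finset.coe_filter, Finset.mem_univ, true_and,
      Set.mem_ofPred_eq]
    constructor
    · rintro ⟨z, hz, he⟩
      have : z = ![a, b] := by rw [← Equiv.eq_symm_apply] at he; simpa using he
      rwa [← this]
    · intro h
      exact ⟨_, h, rfl⟩
  rw [h, add_comm, zeros, Finset.card_filter_add_card_filter_not, Finset.card_univ,
    Fintype.card_prod]

end Code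

/-! ### Weights of products of lines, column by column. -/

section Weight

variable {F : Type*} [Field F] [Fintype F] [DecidableEq F]

/-- The number of points of the lines in `M` with first coordinate `x`. -/
def fiberCard (M : Finset (F × F)) (x : F) : ℕ := (M.image fun p => p.1 * x + p.2).card

/-- Columns over `R` consist of zeros; any other column contains `fiberCard M x` of them. -/
theorem weight_lineProd {k : F} (hk : k ≠ 0) (R : Finset F) (M : Finset (F × F)) :
    weight (lineProd k R M) + ∑ x ∈ Rᶜ, fiberCard M x =
      (Fintype.card F - R.card) * Fintype.card F := by
  have hz : (zeros (lineProd k R M)).card = ∑ x : F,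
      if x ∈ R then Fintype.card F else fiberCard M x := by
    rw [zeros, Finset.card_filter, Fintype.sum_prod_type]
    refine Finset.sum_congr rfl fun x _ => ?_
    rw [← Finset.card_filter]
    split_ifs with h
    · simp [lineProd_eq_zero hk, h, Finset.card_univ]
    · unfold fiberCard
      congr 1
      ext y
      simp only [lineProd_eq_zero hk, h, false_or, Finset.mem_filter, Finset.mem_univ, true_and]
  have hw := weight_add_card_zeros (lineProd k R M)
  rw [hz, Finset.sum_ite, Finset.sum_const, smul_eq_mul] at hw
  have h1 : (Finset.univ.filter fun x => x ∈ R) = R := by ext; simp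
  have h2 : (Finset.univ.filter fun x => x ∉ R) = Rᶜ := by ext; simp
  rw [h1, h2] at hw
  rw [Nat.sub_mul]
  omega

theorem weight_lineProd_of_injOn {k : F} (hk : k ≠ 0) {R : Finset F} {M : Finset (F × F)}
    (h : ∀ x ∉ R, Set.InjOn (fun p : F × F => p.1 * x + p.2) M) :
    weight (lineProd k R M) = (Fintype.card F - R.card) * (Fintype.card F - M.card) := by
  have hw := weight_lineProd hk R M
  have hc : ∀ x ∈ Rᶜ, fiberCard M x = M.card := fun x hx =>
    Finset.card_image_of_injOn (h x (Finset.mem_compl.1 hx))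
  rw [Finset.sum_congr rfl hc, Finset.sum_const, smul_eq_mul, Finset.card_compl] at hw
  rw [Nat.mul_sub]
  omega

/-- Each column off `R` has at most `M.card` zeros, so a single crossing there pushes the weight
strictly above the bound. -/
theorem injOn_of_weight_lineProd_le {k : F} (hk : k ≠ 0) {R : Finset F} {M : Finset (F × F)}
    (hM : M.card ≤ Fintype.card F)
    (h : weight (lineProd k R M) ≤ (Fintype.card F - R.card) * (Fintype.card F - M.card)) :
    ∀ x ∉ R, Set.InjOn (fun p : F × F => p.1 * x + p.2) M := by
  intro x hx
  by_contra hinj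
  have hlt : fiberCard M x < M.card :=
    lt_of_le_of_ne Finset.card_image_le fun he => hinj (Finset.card_image_iff.1 he)
  have hsum : ∑ x ∈ Rᶜ, fiberCard M x < ∑ _x ∈ Rᶜ, M.card :=
    Finset.sum_lt_sum (fun _ _ => Finset.card_image_le) ⟨x, by simpa using hx, hlt⟩
  have hw := weight_lineProd hk R M
  rw [Finset.sum_const, smul_eq_mul, Finset.card_compl] at hsum
  rw [Nat.mul_sub] at h
  have := Nat.mul_le_mul_left (Fintype.card F - R.card) hM
  omega

/-- Used to add the lines of a column one at a time: each coincidence `p` saves one point. -/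
theorem card_insert_add_ite_le {α : Type*} [DecidableEq α] {p : Prop} [Decidable p] {a : α}
    {s : Finset α} (h : p → a ∈ s) : (insert a s).card + (if p then 1 else 0) ≤ s.card + 1 := by
  split_ifs with hp
  · rw [Finset.insert_eq_of_mem (h hp)]
  · exact Finset.card_insert_le _ _

/-- Four lines of different slopes and a line `x = r` either all meet in one point, or have few
points in their union. -/
theorem four_slopes {k : F} (hk : k ≠ 0) {r : F} {M : Finset (F × F)} (hM : M.card = 4)
    (hq : 4 ≤ Fintype.card F) (hslope : Set.InjOn Prod.fst (M : Set (F × F))) :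
    weight (lineProd k {r} M) = (Fintype.card F - 1) * (Fintype.card F - 4) ∨
      (Fintype.card F - 1) * (Fintype.card F - 4) + 3 ≤ weight (lineProd k {r} M) := by
  by_cases hall : ∀ p ∈ M, ∀ p' ∈ M, p.1 * r + p.2 = p'.1 * r + p'.2
  · left
    rw [weight_lineProd_of_injOn hk, hM, Finset.card_singleton]
    intro x hx p hp p' hp' he
    have hx' : x - r ≠ 0 := sub_ne_zero.2 (by simpa using hx)
    refine hslope hp hp' ?_
    have h1 := hall p hp p' hp'
    have h2 : p.1 * x + p.2 = p'.1 * x + p'.2 := he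
    have h3 : (p.1 - p'.1) * (x - r) = 0 := by linear_combination h2 - h1
    exact sub_eq_zero.1 ((mul_eq_zero.1 h3).resolve_right hx')
  · right
    push Not at hall
    obtain ⟨A, hA, B, hB, hAB⟩ := hall
    have hmeet : ∀ p ∈ M, ∀ p' ∈ M, p.1 * r + p.2 ≠ p'.1 * r + p'.2 →
        ∃ x, x ≠ r ∧ p.1 * x + p.2 = p'.1 * x + p'.2 := by
      intro p hp p' hp' hne
      have hs : p.1 - p'.1 ≠ 0 := by
        rw [sub_ne_zero]
        intro h
        exact hne (by rw [hslope hp hp' h])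
      have hx : p.1 * ((p'.2 - p.2) / (p.1 - p'.1)) + p.2 =
          p'.1 * ((p'.2 - p.2) / (p.1 - p'.1)) + p'.2 := by field_simp; ring
      exact ⟨_, fun h => hne (h ▸ hx), hx⟩
    have hABne : A ≠ B := fun h => hAB (by rw [h])
    have h2 : ((M.erase A).erase B).card = 2 := by
      rw [Finset.card_erase_of_mem (by simp [hB, hABne.symm]), Finset.card_erase_of_mem hA, hM]
    obtain ⟨C, D, hCD, hE⟩ := Finset.card_eq_two.1 h2
    have hMeq : M = {D, C, B, A} := by
      ext p
      have := Finset.ext_iff.1 hE p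
      simp only [Finset.mem_erase, Finset.mem_insert, Finset.mem_singleton] at this ⊢
      grind
    have hC : C ∈ M := by rw [hMeq]; simp
    have hD : D ∈ M := by rw [hMeq]; simp
    obtain ⟨x₁, hx₁, he₁⟩ := hmeet A hA B hB hAB
    -- `A` and `B` take different values at `r`, so any line differs there from one of them, and
    -- crosses that one off the column `x = r`.
    have hother : ∀ p ∈ M, ∃ x, x ≠ r ∧
        (p.1 * x + p.2 = A.1 * x + A.2 ∨ p.1 * x + p.2 = B.1 * x + B.2) := by
      intro p hp
      by_cases h : p.1 * r + p.2 = A.1 * r + A.2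
      · obtain ⟨x, hx, he⟩ := hmeet p hp B hB (h ▸ hAB)
        exact ⟨x, hx, Or.inr he⟩
      · obtain ⟨x, hx, he⟩ := hmeet p hp A hA h
        exact ⟨x, hx, Or.inl he⟩
    obtain ⟨x₂, hx₂, he₂⟩ := hother C hC
    obtain ⟨x₃, hx₃, he₃⟩ := hother D hD
    -- Adding `B`, `C`, `D` in turn to `A`, each loses a point, at `x₁`, `x₂`, `x₃`. The three
    -- losses add up even if these abscissas coincide.
    have hpt : ∀ x, fiberCard M x + ((if x = x₁ then 1 else 0) + (if x = x₂ then 1 else 0) +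
        (if x = x₃ then 1 else 0)) ≤ 4 := by
      intro x
      have h1 := card_insert_add_ite_le (p := x = x₁) (a := B.1 * x + B.2)
        (s := {A.1 * x + A.2}) (by rintro rfl; simp [he₁])
      have h2 := card_insert_add_ite_le (p := x = x₂) (a := C.1 * x + C.2)
        (s := {B.1 * x + B.2, A.1 * x + A.2}) (by rintro rfl; simp [he₂.symm])
      have h3 := card_insert_add_ite_le (p := x = x₃) (a := D.1 * x + D.2)
        (s := {C.1 * x + C.2, B.1 * x + B.2, A.1 * x + A.2})
        (by rintro rfl; rcases he₃ with h | h <;> simp [h])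
      have h4 : fiberCard M x = Finset.card
          {D.1 * x + D.2, C.1 * x + C.2, B.1 * x + B.2, A.1 * x + A.2} := by
        simp [fiberCard, hMeq, Finset.image_insert]
      rw [Finset.card_singleton] at h1
      omega
    have hsum := Finset.sum_le_sum (s := ({r} : Finset F)ᶜ) fun x _ => hpt x
    rw [Finset.sum_add_distrib, Finset.sum_add_distrib, Finset.sum_add_distrib,
      Finset.sum_ite_eq', Finset.sum_ite_eq', Finset.sum_ite_eq', if_pos (by simpa),
      if_pos (by simpa), if_pos (by simpa), Finset.sum_const, smul_eq_mul, Finset.card_compl,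
      Finset.card_singleton] at hsum
    have hw := weight_lineProd hk {r} M
    rw [Finset.card_singleton] at hw
    rw [Nat.mul_sub]
    have := Nat.mul_le_mul_left (Fintype.card F - 1) hq
    omega

end Weight

/-! ### Normalizing the largest parallel class. -/

section Affine

variable {F : Type*} [Field F]

/-- The affine transformation `(x, y) ↦ (a x + b y + e, c x + d y + f)`. -/
def planeAffine (a b c d e f : F) (h : a * d - b * c ≠ 0) :
    (Fin 2 → F) ≃ᵃ[F] (Fin 2 → F) :=
  (LinearEquiv.toAffineEquiv
    { toFun := fun z => ![a * z 0 + b * z 1, c * z 0 + d * z 1]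
      map_add' := fun z w => by
        ext i; fin_cases i <;> simp <;> ring
      map_smul' := fun t z => by
        ext i; fin_cases i <;> simp <;> ring
      invFun := fun z => ![(d * z 0 - b * z 1) / (a * d - b * c),
        (a * z 1 - c * z 0) / (a * d - b * c)]
      left_inv := fun z => by
        ext i; fin_cases i <;> simp <;> rw [div_eq_iff h] <;> ring
      right_inv := fun z => by
        ext i
        fin_cases i
        · change a * ((d * z 0 - b * z 1) / (a * d - b * c)) +
            b * ((a * z 1 - c * z 0) / (a * d - b * c)) = z 0
          rw [← mul_div_assoc, ← mul_div_assoc, ← add_div, div_eq_iff h]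
          ring
        · change c * ((d * z 0 - b * z 1) / (a * d - b * c)) +
            d * ((a * z 1 - c * z 0) / (a * d - b * c)) = z 1
          rw [← mul_div_assoc, ← mul_div_assoc, ← add_div, div_eq_iff h]
          ring }).trans
    (AffineEquiv.constVAdd F (Fin 2 → F) ![e, f])

@[simp] theorem planeAffine_apply (a b c d e f : F) (h : a * d - b * c ≠ 0) (x y : F) :
    planeAffine a b c d e f h ![x, y] = ![a * x + b * y + e, c * x + d * y + f] := by
  ext i
  fin_cases i <;> simp [planeAffine, add_comm]

/-- The number of lines `x = r` on which a function vanishes. -/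
def verticalCard [Fintype F] [DecidableEq F] (g : (Fin 2 → F) → F) : ℕ :=
  (Finset.univ.filter fun r => ∀ y, g ![r, y] = 0).card

theorem exists_max_verticalCard [Fintype F] [DecidableEq F] (f : (Fin 2 → F) → F) :
    ∃ T : (Fin 2 → F) ≃ᵃ[F] (Fin 2 → F), ∀ T' : (Fin 2 → F) ≃ᵃ[F] (Fin 2 → F),
      verticalCard (f ∘ T') ≤ verticalCard (f ∘ T) := by
  have : Finite ((Fin 2 → F) ≃ᵃ[F] (Fin 2 → F)) :=
    Finite.of_injective (fun T => (T : (Fin 2 → F) → (Fin 2 → F))) DFunLike.coe_injective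
  have : Nonempty ((Fin 2 → F) ≃ᵃ[F] (Fin 2 → F)) := ⟨AffineEquiv.refl F _⟩
  exact Finite.exists_max fun T : (Fin 2 → F) ≃ᵃ[F] (Fin 2 → F) => verticalCard (f ∘ T)

theorem verticalCard_lineProd [Fintype F] [DecidableEq F] {k : F} (hk : k ≠ 0) {R : Finset F}
    {M : Finset (F × F)} (hM : M.card < Fintype.card F) :
    verticalCard (lineProd k R M) = R.card := by
  unfold verticalCard
  congr 1
  ext r
  simp only [lineProd_eq_zero hk, Finset.mem_filter, Finset.mem_univ, true_and]
  refine ⟨fun h => ?_, fun h _ => Or.inl h⟩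
  by_contra hr
  have h1 : (Finset.univ : Finset F) ⊆ M.image fun p => p.1 * r + p.2 :=
    fun y _ => (h y).resolve_left hr
  have h2 := (Finset.card_le_card h1).trans Finset.card_image_le
  rw [Finset.card_univ] at h2
  omega

/-- The map `(x, y) ↦ (y, x + m y)` pulls the line of slope `m` and intercept `c` back to `x = c`.
-/
theorem card_slope_le_verticalCard [Fintype F] [DecidableEq F] {k : F} (hk : k ≠ 0)
    {R : Finset F} {M : Finset (F × F)} (m : F) :
    (M.filter fun p => p.1 = m).card ≤
      verticalCard (lineProd k R M ∘ planeAffine 0 1 1 m 0 0 (by simp)) := by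
  refine Finset.card_le_card_of_injOn Prod.snd ?_ ?_
  · rintro ⟨m', c⟩ hp
    simp only [Finset.coe_filter, Set.mem_ofPred_eq] at hp
    obtain ⟨hp, rfl⟩ := hp
    simp only [Finset.coe_filter, Set.mem_ofPred_eq, Finset.mem_univ, true_and,
      Function.comp_apply, planeAffine_apply, lineProd_eq_zero hk, Finset.mem_image]
    exact fun y => Or.inr ⟨_, hp, by ring⟩
  · rintro ⟨m', c⟩ hp ⟨m'', c'⟩ hp' h
    simp only [Finset.coe_filter, Set.mem_ofPred_eq] at hp hp' h
    rw [hp.2, hp'.2, h]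

end Affine

/-! ### The extremal line configurations and the classification. -/

section Forms

variable {F : Type*} [Field F]

/-- `g` is, up to an affine transformation, one of the four kinds of words of third weight. -/
def IsThirdWord (g : (Fin 2 → F) → F) : Prop :=
  ∃ T : (Fin 2 → F) ≃ᵃ[F] (Fin 2 → F),
    IsGridWord (g ∘ T) ∨ IsPencilWord (g ∘ T) ∨ IsTripleParallelWord (g ∘ T) ∨
      IsDiagonalWord (g ∘ T)

theorem IsThirdWord.of_comp {g : (Fin 2 → F) → F} (T : (Fin 2 → F) ≃ᵃ[F] (Fin 2 → F))
    (h : IsThirdWord (g ∘ T)) : IsThirdWord g := by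
  obtain ⟨T', h⟩ := h
  exact ⟨T'.trans T, h⟩

variable [DecidableEq F]

theorem isThirdWord_grid {k r₁ r₂ r₃ m c d : F} (hk : k ≠ 0) (h₁₂ : r₁ ≠ r₂) (h₁₃ : r₁ ≠ r₃)
    (h₂₃ : r₂ ≠ r₃) (hcd : c ≠ d) :
    IsThirdWord (lineProd k {r₁, r₂, r₃} {(m, c), (m, d)}) := by
  -- Besides shearing the slope `m` away, the scaling removes the constant: `k · k⁻³ · k² = 1`.
  refine ⟨planeAffine k⁻¹ 0 (m * k⁻¹) k 0 0 (by simp [hk]), Or.inl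
    ⟨![k * r₁, k * r₂, k * r₃], c / k, d / k, ?_, ?_, fun x y => ?_⟩⟩
  · intro i j hij
    fin_cases i <;> fin_cases j <;> simp_all [eq_comm]
  · rwa [ne_eq, div_left_inj' hk]
  · simp only [Function.comp_apply, planeAffine_apply, lineProd, Fin.prod_univ_three,
      Matrix.cons_val_zero, Matrix.cons_val_one, Matrix.cons_val]
    rw [Finset.prod_insert (by simp [*]), Finset.prod_insert (by simp [*]),
      Finset.prod_singleton, Finset.prod_insert (by simp [*]), Finset.prod_singleton]
    field_simp
    ring

theorem isThirdWord_triple {k x₀ r₁ r₂ m₁ c₁ m₂ c₂ : F} (hk : k ≠ 0) (h₁ : x₀ ≠ r₁)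
    (h₂ : x₀ ≠ r₂) (h₁₂ : r₁ ≠ r₂) (hm : m₁ ≠ m₂) (h : m₁ * x₀ + c₁ = m₂ * x₀ + c₂) :
    IsThirdWord (lineProd k {x₀, r₁, r₂} {(m₁, c₁), (m₂, c₂)}) := by
  -- The common point moves to the origin, and `k` is absorbed into the second linear form.
  refine ⟨planeAffine 1 0 0 1 x₀ (m₁ * x₀ + c₁) (by simp), Or.inr (Or.inr (Or.inl
    ⟨![1, -(k * m₁), -m₂], ![0, k, 1], ![x₀ - r₁, x₀ - r₂], ?_, ?_, ?_, ?_, fun x y => ?_⟩))⟩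
  · intro i
    fin_cases i <;> simp [hk]
  · have e₁ : k * (m₂ - m₁) ≠ 0 := mul_ne_zero hk (sub_ne_zero.2 hm.symm)
    intro i j hij
    fin_cases i <;> fin_cases j <;>
      simp only [Fin.zero_eta, Fin.mk_one, Fin.reduceFinMk, Matrix.cons_val_zero,
        Matrix.cons_val_one, Matrix.cons_val] <;>
      first
        | exact absurd rfl hij
        | (intro h; exact e₁ (by linear_combination h))
        | (intro h; exact e₁ (by linear_combination -h))
        | simp [hk]
  · intro j
    fin_cases j <;> simp [sub_eq_zero, *]
  · intro i j hij
    fin_cases i <;> fin_cases j <;> simp_all [eq_comm]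
  · have hc : c₂ = m₁ * x₀ + c₁ - m₂ * x₀ := by linear_combination -h
    simp only [Function.comp_apply, planeAffine_apply, lineProd, Fin.prod_univ_three,
      Fin.prod_univ_two, Matrix.cons_val_zero, Matrix.cons_val_one, Matrix.cons_val]
    rw [Finset.prod_insert (by simp [h₁, h₂]), Finset.prod_insert (by simp [h₁₂]),
      Finset.prod_singleton, Finset.prod_insert (by simp [hm]),
    Finset.prod_singleton]
    simp only [hc]
    ring

theorem isThirdWord_pencil {k x₀ r m₁ c₁ m₂ c₂ m₃ c₃ : F} (hk : k ≠ 0) (hr : x₀ ≠ r)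
    (h₁₂ : m₁ ≠ m₂) (h₁₃ : m₁ ≠ m₃) (h₂₃ : m₂ ≠ m₃) (h₂ : m₁ * x₀ + c₁ = m₂ * x₀ + c₂)
    (h₃ : m₁ * x₀ + c₁ = m₃ * x₀ + c₃) :
    IsThirdWord (lineProd k {x₀, r} {(m₁, c₁), (m₂, c₂), (m₃, c₃)}) := by
  refine ⟨planeAffine 1 0 0 1 x₀ (m₁ * x₀ + c₁) (by simp), Or.inr (Or.inl
    ⟨![1, -(k * m₁), -m₂, -m₃], ![0, k, 1, 1], x₀ - r, ?_, ?_, sub_ne_zero.2 hr,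
      fun x y => ?_⟩)⟩
  · intro i
    fin_cases i <;> simp [hk]
  · have e₁ : k * (m₂ - m₁) ≠ 0 := mul_ne_zero hk (sub_ne_zero.2 h₁₂.symm)
    have e₂ : k * (m₃ - m₁) ≠ 0 := mul_ne_zero hk (sub_ne_zero.2 h₁₃.symm)
    have e₃ : m₃ - m₂ ≠ 0 := sub_ne_zero.2 h₂₃.symm
    intro i j hij
    fin_cases i <;> fin_cases j <;>
      simp only [Fin.zero_eta, Fin.mk_one, Fin.reduceFinMk, Matrix.cons_val_zero,
        Matrix.cons_val_one, Matrix.cons_val] <;>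
      first
        | exact absurd rfl hij
        | (intro h; exact e₁ (by linear_combination h))
        | (intro h; exact e₁ (by linear_combination -h))
        | (intro h; exact e₂ (by linear_combination h))
        | (intro h; exact e₂ (by linear_combination -h))
        | (intro h; exact e₃ (by linear_combination h))
        | (intro h; exact e₃ (by linear_combination -h))
        | simp [hk]
  · have hc₂ : c₂ = m₁ * x₀ + c₁ - m₂ * x₀ := by linear_combination -h₂
    have hc₃ : c₃ = m₁ * x₀ + c₁ - m₃ * x₀ := by linear_combination -h₃
    simp only [Function.comp_apply, planeAffine_apply, lineProd, Fin.prod_univ_four,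
      Matrix.cons_val_zero, Matrix.cons_val_one, Matrix.cons_val]
    rw [Finset.prod_insert (by simp [hr]), Finset.prod_singleton,
      Finset.prod_insert (by simp [h₁₂, h₁₃]), Finset.prod_insert (by simp [h₂₃]),
      Finset.prod_singleton]
    simp only [hc₂, hc₃]
    ring

theorem isThirdWord_diagonal {k a b m c d m' c' : F} (hk : k ≠ 0) (hab : a ≠ b) (hcd : c ≠ d)
    (hm : m ≠ m') (ha : m * a + c = m' * a + c') (hb : m * b + d = m' * b + c') :
    IsThirdWord (lineProd k {a, b} {(m, c), (m, d), (m', c')}) := by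
  have hab' : a - b ≠ 0 := sub_ne_zero.2 hab
  -- After the shear the third line joins `(a, c)` to `(b, d)`; clearing the denominator of its
  -- slope turns `k` into `k / (a - b)`.
  refine ⟨planeAffine 1 0 m 1 0 0 (by simp), Or.inr (Or.inr (Or.inr
    ⟨k / (a - b), a, b, c, d, div_ne_zero hk hab', hab, hcd, fun x y => ?_⟩))⟩
  have hm' : m' = m + (c - d) / (a - b) := by
    field_simp
    linear_combination hb - ha
  have hc' : c' = m * a + c - m' * a := by linear_combination -ha
  simp only [Function.comp_apply, planeAffine_apply, lineProd, Matrix.cons_val_zero,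
    Matrix.cons_val_one]
  rw [Finset.prod_insert (by simp [hab]), Finset.prod_singleton,
    Finset.prod_insert (by simp [hcd, hm]), Finset.prod_insert (by simp [hm]),
    Finset.prod_singleton]
  simp only [hc', hm']
  field_simp
  ring

/-- Two lines of different slopes that are not separated off `R` meet on a line `x = r`,
`r ∈ R`. -/
theorem exists_meet {R : Finset F} {M : Finset (F × F)}
    (h : ∀ x ∉ R, Set.InjOn (fun p : F × F => p.1 * x + p.2) M) {p p' : F × F} (hp : p ∈ M)
    (hp' : p' ∈ M) (hne : p.1 ≠ p'.1) : ∃ x ∈ R, p.1 * x + p.2 = p'.1 * x + p'.2 := by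
  have hs : p.1 - p'.1 ≠ 0 := sub_ne_zero.2 hne
  have hx : p.1 * ((p'.2 - p.2) / (p.1 - p'.1)) + p.2 =
      p'.1 * ((p'.2 - p.2) / (p.1 - p'.1)) + p'.2 := by field_simp; ring
  refine ⟨_, ?_, hx⟩
  by_contra hR
  exact hne (by rw [h _ hR hp hp' hx])


theorem isThirdWord_of_card_three {k : F} (hk : k ≠ 0) {R : Finset F} {M : Finset (F × F)}
    (hR : R.card = 3) (hM : M.card = 2)
    (h : ∀ x ∉ R, Set.InjOn (fun p : F × F => p.1 * x + p.2) M) :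
    IsThirdWord (lineProd k R M) := by
  obtain ⟨⟨m₁, c₁⟩, ⟨m₂, c₂⟩, hne, rfl⟩ := Finset.card_eq_two.1 hM
  by_cases hm : m₁ = m₂
  · subst hm
    obtain ⟨r₁, r₂, r₃, h₁₂, h₁₃, h₂₃, rfl⟩ := Finset.card_eq_three.1 hR
    exact isThirdWord_grid hk h₁₂ h₁₃ h₂₃ fun h => hne (by rw [h])
  · obtain ⟨x₀, hx₀, he⟩ := exists_meet h (p := (m₁, c₁)) (p' := (m₂, c₂)) (by simp) (by simp) hm
    have h2 : (R.erase x₀).card = 2 := by rw [Finset.card_erase_of_mem hx₀, hR]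
    obtain ⟨r₁, r₂, h₁₂, hE⟩ := Finset.card_eq_two.1 h2
    have hnot := Finset.notMem_erase x₀ R
    rw [← Finset.insert_erase hx₀, hE]
    rw [hE] at hnot
    simp only [Finset.mem_insert, Finset.mem_singleton, not_or] at hnot
    exact isThirdWord_triple hk hnot.1 hnot.2 h₁₂ hm he

/-- With three slopes, the three crossings lie over two abscissas, so two of them share one and the
lines are concurrent: a pencil. Otherwise, by `hmax`, exactly two lines are parallel, and the third
crosses them over the two different points of `R`: a diagonal. -/
theorem isThirdWord_of_card_two {k : F} (hk : k ≠ 0) {R : Finset F} {M : Finset (F × F)}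
    (hR : R.card = 2) (hM : M.card = 3) (hmax : ∀ m, (M.filter fun p => p.1 = m).card ≤ 2)
    (h : ∀ x ∉ R, Set.InjOn (fun p : F × F => p.1 * x + p.2) M) :
    IsThirdWord (lineProd k R M) := by
  have hRpair : ∀ x ∈ R, ∃ r, x ≠ r ∧ R = {x, r} := by
    intro x hx
    have h1 : (R.erase x).card = 1 := by rw [Finset.card_erase_of_mem hx, hR]
    obtain ⟨r, hr⟩ := Finset.card_eq_one.1 h1
    refine ⟨r, ?_, by rw [← Finset.insert_erase hx, hr]⟩
    have := Finset.notMem_erase x R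
    rw [hr] at this
    simpa using this
  by_cases hinj : Set.InjOn Prod.fst (M : Set (F × F))
  · obtain ⟨⟨m₁, c₁⟩, ⟨m₂, c₂⟩, ⟨m₃, c₃⟩, h₁₂, h₁₃, h₂₃, rfl⟩ := Finset.card_eq_three.1 hM
    have n₁₂ : m₁ ≠ m₂ := fun e => h₁₂ (hinj (by simp) (by simp) e)
    have n₁₃ : m₁ ≠ m₃ := fun e => h₁₃ (hinj (by simp) (by simp) e)
    have n₂₃ : m₂ ≠ m₃ := fun e => h₂₃ (hinj (by simp) (by simp) e)
    obtain ⟨x, hx, ex⟩ := exists_meet h (p := (m₁, c₁)) (p' := (m₂, c₂)) (by simp) (by simp) n₁₂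
    obtain ⟨y, hy, ey⟩ := exists_meet h (p := (m₁, c₁)) (p' := (m₃, c₃)) (by simp) (by simp) n₁₃
    obtain ⟨z, hz, ez⟩ := exists_meet h (p := (m₂, c₂)) (p' := (m₃, c₃)) (by simp) (by simp) n₂₃
    have hcommon : ∃ x₀ ∈ R, m₁ * x₀ + c₁ = m₂ * x₀ + c₂ ∧ m₁ * x₀ + c₁ = m₃ * x₀ + c₃ := by
      by_cases hxy : x = y
      · exact ⟨x, hx, ex, hxy ▸ ey⟩
      obtain ⟨r, -, rfl⟩ := hRpair x hx
      simp only [Finset.mem_insert, Finset.mem_singleton] at hy hz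
      rcases hz with rfl | rfl
      · exact ⟨z, hx, ex, ex.trans ez⟩
      · obtain rfl : y = z := hy.resolve_left (Ne.symm hxy)
        exact ⟨y, by simp, ey.trans ez.symm, ey⟩
    obtain ⟨x₀, hx₀, e₂, e₃⟩ := hcommon
    obtain ⟨r, hr, rfl⟩ := hRpair x₀ hx₀
    exact isThirdWord_pencil hk hr n₁₂ n₁₃ n₂₃ e₂ e₃
  · simp only [Set.InjOn, not_forall] at hinj
    obtain ⟨⟨m, c⟩, hp, ⟨m', d⟩, hp', rfl : m = m', hne⟩ := hinj
    have hcd : c ≠ d := fun e => hne (by rw [e])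
    have h1 : ((M.erase (m, c)).erase (m, d)).card = 1 := by
      rw [Finset.card_erase_of_mem (Finset.mem_erase.2 ⟨fun e => hne e.symm, hp'⟩),
        Finset.card_erase_of_mem hp, hM]
    obtain ⟨⟨m', c'⟩, hE⟩ := Finset.card_eq_one.1 h1
    have hMeq : M = {(m, c), (m, d), (m', c')} := by
      rw [← Finset.insert_erase hp, ← Finset.insert_erase
        (Finset.mem_erase.2 ⟨fun e => hne e.symm, hp'⟩), hE]
    have hm : m ≠ m' := by
      rintro rfl
      have h3 := hmax m
      rw [Finset.filter_true_of_mem (by rw [hMeq]; simp), hM] at h3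
      omega
    have hq : (m', c') ∈ M := by rw [hMeq]; simp
    obtain ⟨a, ha, ea⟩ := exists_meet h hp hq hm
    obtain ⟨b, hb, eb⟩ := exists_meet h hp' hq hm
    have hab : a ≠ b := by
      rintro rfl
      exact hcd (add_left_cancel (ea.trans eb.symm))
    obtain ⟨r, hr, rfl⟩ := hRpair a ha
    obtain rfl : b = r := by simpa [Ne.symm hab] using hb
    rw [hMeq]
    exact isThirdWord_diagonal hk hab hcd hm ea eb

/-- The words of degree at most `5` and weight at most `(q - 3) (q - 2)`. -/
theorem classification [Fintype F] (hq : 13 ≤ Fintype.card F) {f : (Fin 2 → F) → F}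
    (hf : f ∈ code F 5 2) (hf0 : f ≠ 0) (hw : weight f ≤ (Fintype.card F - 3) * (Fintype.card F - 2)) :
    weight f = (Fintype.card F - 5) * Fintype.card F ∨
      weight f = (Fintype.card F - 4) * (Fintype.card F - 1) ∨ IsThirdWord f := by
  obtain ⟨T, hT⟩ := exists_max_verticalCard f
  have hfT := comp_mem_code (by omega) hf T
  have hwT := weight_comp f T
  have hfT0 : f ∘ T ≠ 0 := by
    intro h0
    refine hf0 (funext fun z => ?_)
    have := congrFun h0 (T.symm z)
    simpa using this
  obtain ⟨P, hP, he⟩ := (mem_code_iff (by omega)).1 hfT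
  have hP0 : P ≠ 0 := by
    rintro rfl
    exact hfT0 (funext fun z => by rw [← he]; simp)
  have he' : (fun z => MvPolynomial.eval z P) = f ∘ T := funext he
  have hz := weight_add_card_zeros (f ∘ T)
  obtain ⟨n, hn⟩ : ∃ n, Fintype.card F = n + 13 := ⟨_, (Nat.sub_add_cancel hq).symm⟩
  have e3 : Fintype.card F - 3 = n + 10 := by omega
  have e2 : Fintype.card F - 2 = n + 11 := by omega
  have e4 : Fintype.card F - 4 = n + 9 := by omega
  have e1 : Fintype.card F - 1 = n + 12 := by omega
  -- The number of zeros is at least `q² - (q - 3) (q - 2) = 5 q - 6`.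
  obtain ⟨k, R, M, hk, hRM, hkRM⟩ := exists_eq_lineProd_of_card_zeros hq P hP0 hP (by
    rw [he']
    rw [e3, e2] at hw
    rw [hwT, hn] at hz
    rw [hn]
    nlinarith)
  have hg : f ∘ T = lineProd k R M := by
    funext z
    rw [← he, show z = ![z 0, z 1] by ext i; fin_cases i <;> rfl, hkRM]
  have hvert : verticalCard (f ∘ T) = R.card := by
    rw [hg, verticalCard_lineProd hk (by omega)]
  -- By the choice of `T`, no parallel class is larger than the vertical one.
  have hmax : ∀ m, (M.filter fun p => p.1 = m).card ≤ R.card := by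
    intro m
    refine (card_slope_le_verticalCard hk (R := R) m).trans ?_
    rw [← hvert, ← hg]
    exact hT ((planeAffine 0 1 1 m 0 0 (by simp)).trans T)
  rw [← hwT] at hw ⊢
  have hinj := injOn_of_weight_lineProd_le hk (R := R) (M := M) (by omega)
  have hR5 : R.card ≤ 5 := by omega
  rw [hg] at hw ⊢
  interval_cases hRc : R.card
  · obtain ⟨p, hp⟩ : M.Nonempty := Finset.card_pos.1 (by omega)
    have := Finset.card_pos.2 ⟨p, Finset.mem_filter (p := fun p' => p'.1 = p.1).2 ⟨hp, rfl⟩⟩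
    have := hmax p.1
    omega
  · obtain ⟨r, rfl⟩ := Finset.card_eq_one.1 hRc
    have hslope : Set.InjOn Prod.fst (M : Set (F × F)) := by
      intro p hp p' hp' h
      exact Finset.card_le_one.1 (hmax p.1) p (by simpa using hp) p' (by simpa [h] using hp')
    rcases four_slopes hk (r := r) (M := M) (by omega) (by omega) hslope with h | h
    · exact Or.inr (Or.inl (by rw [h, mul_comm]))
    -- `(q - 1) (q - 4) + 3` exceeds `(q - 3) (q - 2)` by exactly one.
    · exfalso
      rw [e3, e2] at hw
      rw [e1, e4] at h
      nlinarith
  · obtain hMc : M.card = 3 := by omega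
    rw [hMc, mul_comm] at hinj
    exact Or.inr (Or.inr ((hg ▸ isThirdWord_of_card_two hk hRc hMc hmax (hinj hw) :
      IsThirdWord (f ∘ T)).of_comp))
  · obtain hMc : M.card = 2 := by omega
    rw [hMc] at hinj
    exact Or.inr (Or.inr ((hg ▸ isThirdWord_of_card_three hk hRc hMc (hinj hw) :
      IsThirdWord (f ∘ T)).of_comp))
  · obtain ⟨p, rfl⟩ := Finset.card_eq_one.1 (show M.card = 1 by omega)
    refine Or.inr (Or.inl ?_)
    rw [weight_lineProd_of_injOn hk (by simp), hRc, Finset.card_singleton]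
  · obtain rfl := Finset.card_eq_zero.1 (show M.card = 0 by omega)
    refine Or.inl ?_
    rw [weight_lineProd_of_injOn hk (by simp), hRc, Finset.card_empty, Nat.sub_zero]

end Forms

/-! ### Degree and weight of the four forms. -/

section Converse

variable {F : Type*} [Field F]

theorem lineProd_mem_code [Fintype F] {r : ℕ} (hr : r < Fintype.card F) (k : F) {R : Finset F}
    {M : Finset (F × F)} (h : R.card + M.card ≤ r) : lineProd k R M ∈ code F r 2 := by
  open MvPolynomial in
  refine (mem_code_iff hr).2 ⟨C k * ((∏ r ∈ R, (X 0 - C r)) *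
    ∏ p ∈ M, (X 1 - C p.1 * X 0 - C p.2)), ?_, fun z => by simp [lineProd]⟩
  have h1 (a : F) : (X 0 - C a : MvPolynomial (Fin 2) F).totalDegree ≤ 1 :=
    (totalDegree_sub _ _).trans (by simp)
  have h2 (p : F × F) : (X 1 - C p.1 * X 0 - C p.2 : MvPolynomial (Fin 2) F).totalDegree ≤ 1 := by
    refine (totalDegree_sub _ _).trans (max_le ((totalDegree_sub _ _).trans (max_le ?_ ?_)) ?_)
    · simp
    · exact (totalDegree_mul _ _).trans (by simp)
    · simp
  refine (totalDegree_mul _ _).trans ?_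
  rw [totalDegree_C, zero_add]
  refine (totalDegree_mul _ _).trans (le_trans (add_le_add ?_ ?_) h)
  · exact (totalDegree_finsetProd _ _).trans
      ((Finset.sum_le_sum fun i _ => h1 i).trans (by simp))
  · exact (totalDegree_finsetProd _ _).trans
      ((Finset.sum_le_sum fun i _ => h2 i).trans (by simp))

theorem spec_of_comp_eq_lineProd [Fintype F] [DecidableEq F] (hq : 5 < Fintype.card F)
    {f : (Fin 2 → F) → F} {T : (Fin 2 → F) ≃ᵃ[F] (Fin 2 → F)} {k : F} (hk : k ≠ 0)
    {R : Finset F} {M : Finset (F × F)} {r s : ℕ} (hR : R.card = r) (hM : M.card = s)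
    (hrs : r + s = 5)
    (h : ∀ x ∉ R, Set.InjOn (fun p : F × F => p.1 * x + p.2) M)
    (he : ∀ x y, f (T ![x, y]) = lineProd k R M ![x, y]) :
    f ∈ code F 5 2 ∧ weight f = (Fintype.card F - r) * (Fintype.card F - s) := by
  have hg : f ∘ T = lineProd k R M := by
    funext z
    rw [show z = ![z 0, z 1] by ext i; fin_cases i <;> rfl]
    exact he _ _
  rw [← comp_mem_code_iff hq T, ← weight_comp f T, hg]
  exact ⟨lineProd_mem_code hq k (by rw [hR, hM, hrs]),
    by rw [weight_lineProd_of_injOn hk h, hR, hM]⟩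

/-- Lines through the origin cross only in the column `x = 0`, which belongs to `R`. -/
theorem injOn_of_central {R : Finset F} (hR : 0 ∈ R) {M : Finset (F × F)}
    (hM : ∀ p ∈ M, p.2 = 0) :
    ∀ x ∉ R, Set.InjOn (fun p : F × F => p.1 * x + p.2) M := by
  rintro x hx p hp p' hp' he
  have hx0 : x ≠ 0 := fun h => hx (h ▸ hR)
  simp only [hM p hp, hM p' hp', add_zero] at he
  exact Prod.ext (mul_right_cancel₀ hx0 he) (by rw [hM p hp, hM p' hp'])

/-- With such `u`, `v`, the map `(x, y) ↦ (u x - b y, v x + a y)` has determinant 1 and turns the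
form `a x + b y` into the coordinate `x`. `linear_form_eq` and `slope_ne` describe the other forms
in these coordinates. -/
theorem exists_linear_eq_one {a b : F} (h : (a, b) ≠ (0, 0)) : ∃ u v, a * u + b * v = 1 := by
  by_cases ha : a = 0
  · have hb : b ≠ 0 := fun hb => h (by rw [ha, hb])
    exact ⟨0, b⁻¹, by simp [hb]⟩
  · exact ⟨a⁻¹, 0, by simp [ha]⟩

theorem slope_ne {a₀ b₀ a₁ b₁ a₂ b₂ u v : F} (huv : a₀ * u + b₀ * v = 1)
    (h₁ : a₀ * b₁ - a₁ * b₀ ≠ 0) (h₂ : a₀ * b₂ - a₂ * b₀ ≠ 0) (h : a₁ * b₂ - a₂ * b₁ ≠ 0) :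
    -(a₁ * u + b₁ * v) / (a₀ * b₁ - a₁ * b₀) ≠ -(a₂ * u + b₂ * v) / (a₀ * b₂ - a₂ * b₀) := by
  rw [ne_eq, div_eq_div_iff h₁ h₂]
  intro he
  exact h (by linear_combination -he - (a₁ * b₂ - a₂ * b₁) * huv)

theorem linear_form_eq {a₀ b₀ a b u v : F} (h : a₀ * b - a * b₀ ≠ 0) (x y : F) :
    a * (u * x + -b₀ * y + 0) + b * (v * x + a₀ * y + 0) =
      (a₀ * b - a * b₀) * (y - -(a * u + b * v) / (a₀ * b - a * b₀) * x - 0) := by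
  rw [sub_zero, mul_sub, ← mul_assoc, mul_div_cancel₀ _ h]
  ring

variable [Fintype F] [DecidableEq F]

theorem IsGridWord.spec (hq : 5 < Fintype.card F) {f : (Fin 2 → F) → F}
    {T : (Fin 2 → F) ≃ᵃ[F] (Fin 2 → F)} (h : IsGridWord (f ∘ T)) :
    f ∈ code F 5 2 ∧ weight f = (Fintype.card F - 3) * (Fintype.card F - 2) := by
  obtain ⟨b, c, d, hb, hcd, he⟩ := h
  have hR : (Finset.univ.image b).card = 3 := by
    rw [Finset.card_image_of_injective _ fun i j h => by_contra fun hij => hb i j hij h]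
    simp
  have hM : ({(0, c), (0, d)} : Finset (F × F)).card = 2 := Finset.card_pair (by simp [hcd])
  refine spec_of_comp_eq_lineProd hq (T := T) one_ne_zero hR hM rfl ?_ fun x y => ?_
  · intro x _
    simp [Set.InjOn, hcd, hcd.symm]
  · rw [← Function.comp_apply (f := f), he, lineProd,
      Finset.prod_image fun i _ j _ h => by_contra fun hij => hb i j hij h,
      Finset.prod_pair (by simp [hcd])]
    simp

theorem IsPencilWord.spec (hq : 5 < Fintype.card F) {f : (Fin 2 → F) → F}
    {T : (Fin 2 → F) ≃ᵃ[F] (Fin 2 → F)} (h : IsPencilWord (f ∘ T)) :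
    f ∈ code F 5 2 ∧ weight f = (Fintype.card F - 3) * (Fintype.card F - 2) := by
  obtain ⟨a, b, e, h0, hab, he0, he⟩ := h
  obtain ⟨u, v, huv⟩ := exists_linear_eq_one (h0 0)
  have h₁ := hab 0 1 (by decide)
  have h₂ := hab 0 2 (by decide)
  have h₃ := hab 0 3 (by decide)
  let m : Fin 4 → F := fun i => -(a i * u + b i * v) / (a 0 * b i - a i * b 0)
  have n₁₂ : m 1 ≠ m 2 := slope_ne huv h₁ h₂ (hab 1 2 (by decide))
  have n₁₃ : m 1 ≠ m 3 := slope_ne huv h₁ h₃ (hab 1 3 (by decide))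
  have n₂₃ : m 2 ≠ m 3 := slope_ne huv h₂ h₃ (hab 2 3 (by decide))
  have hR : ({0, -e} : Finset F).card = 2 :=
    Finset.card_pair (by simpa [eq_comm] using he0)
  have hM : ({(m 1, 0), (m 2, 0), (m 3, 0)} : Finset (F × F)).card = 3 :=
    Finset.card_eq_three.2 ⟨_, _, _, by simpa using n₁₂, by simpa using n₁₃,
      by simpa using n₂₃, rfl⟩
  rw [mul_comm]
  refine spec_of_comp_eq_lineProd hq (T := (planeAffine u (-b 0) v (a 0) 0 0
      (by intro h; exact one_ne_zero (by linear_combination h - huv))).trans T)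
    (mul_ne_zero (mul_ne_zero h₁ h₂) h₃) hR hM rfl
    (injOn_of_central (by simp) (by simp)) fun x y => ?_
  rw [AffineEquiv.trans_apply, planeAffine_apply, ← Function.comp_apply (f := f), he, lineProd,
    Fin.prod_univ_four, linear_form_eq h₁, linear_form_eq h₂, linear_form_eq h₃,
    show a 0 * (u * x + -b 0 * y + 0) + b 0 * (v * x + a 0 * y + 0) = x by
      linear_combination x * huv,
    Finset.prod_pair (by simpa [eq_comm] using he0),
    Finset.prod_insert (by simpa using ⟨n₁₂, n₁₃⟩), Finset.prod_pair (by simpa using n₂₃)]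
  simp only [m, Matrix.cons_val_zero, Matrix.cons_val_one]
  ring

theorem IsTripleParallelWord.spec (hq : 5 < Fintype.card F) {f : (Fin 2 → F) → F}
    {T : (Fin 2 → F) ≃ᵃ[F] (Fin 2 → F)} (h : IsTripleParallelWord (f ∘ T)) :
    f ∈ code F 5 2 ∧ weight f = (Fintype.card F - 3) * (Fintype.card F - 2) := by
  obtain ⟨a, b, e, h0, hab, he0, hee, he⟩ := h
  obtain ⟨u, v, huv⟩ := exists_linear_eq_one (h0 0)
  have h₁ := hab 0 1 (by decide)
  have h₂ := hab 0 2 (by decide)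
  let m : Fin 3 → F := fun i => -(a i * u + b i * v) / (a 0 * b i - a i * b 0)
  have n₁₂ : m 1 ≠ m 2 := slope_ne huv h₁ h₂ (hab 1 2 (by decide))
  have e₀ := he0 0
  have e₁ := he0 1
  have e₀₁ := hee 0 1 (by decide)
  have hR : ({0, -e 0, -e 1} : Finset F).card = 3 :=
    Finset.card_eq_three.2 ⟨_, _, _, by simpa [eq_comm] using e₀, by simpa [eq_comm] using e₁,
      by simpa using e₀₁, rfl⟩
  have hM : ({(m 1, 0), (m 2, 0)} : Finset (F × F)).card = 2 :=
    Finset.card_pair (by simpa using n₁₂)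
  refine spec_of_comp_eq_lineProd hq (T := (planeAffine u (-b 0) v (a 0) 0 0
      (by intro h; exact one_ne_zero (by linear_combination h - huv))).trans T)
    (mul_ne_zero h₁ h₂) hR hM rfl
    (injOn_of_central (by simp) (by simp)) fun x y => ?_
  rw [AffineEquiv.trans_apply, planeAffine_apply, ← Function.comp_apply (f := f), he, lineProd,
    Fin.prod_univ_three, Fin.prod_univ_two, linear_form_eq h₁, linear_form_eq h₂,
    show a 0 * (u * x + -b 0 * y + 0) + b 0 * (v * x + a 0 * y + 0) = x by
      linear_combination x * huv,
    Finset.prod_insert (by simpa using ⟨e₀, e₁⟩),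
    Finset.prod_pair (by simpa using e₀₁), Finset.prod_pair (by simpa using n₁₂)]
  simp only [m, Matrix.cons_val_zero, Matrix.cons_val_one]
  ring

theorem IsDiagonalWord.spec (hq : 5 < Fintype.card F) {f : (Fin 2 → F) → F}
    {T : (Fin 2 → F) ≃ᵃ[F] (Fin 2 → F)} (h : IsDiagonalWord (f ∘ T)) :
    f ∈ code F 5 2 ∧ weight f = (Fintype.card F - 3) * (Fintype.card F - 2) := by
  obtain ⟨l, a, b, c, d, hl, hab, hcd, he⟩ := h
  have hab' : a - b ≠ 0 := sub_ne_zero.2 hab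
  have hcd' : c - d ≠ 0 := sub_ne_zero.2 hcd
  -- The slope of the diagonal through `(a, c)` and `(b, d)`.
  obtain ⟨m, hm⟩ : ∃ m, m * (a - b) = c - d := ⟨(c - d) / (a - b), div_mul_cancel₀ _ hab'⟩
  have hm0 : m ≠ 0 := by rintro rfl; exact hcd' (by rw [← hm, zero_mul])
  have hR : ({a, b} : Finset F).card = 2 := Finset.card_pair hab
  have hM : ({(0, c), (0, d), (m, c - m * a)} : Finset (F × F)).card = 3 :=
    Finset.card_eq_three.2 ⟨_, _, _, by simpa using hcd, by simp [hm0.symm],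
      by simp [hm0.symm], rfl⟩
  rw [mul_comm]
  refine spec_of_comp_eq_lineProd hq (T := T) (mul_ne_zero hl hab') hR hM rfl ?_
    fun x y => ?_
  · intro x hx
    simp only [Finset.mem_insert, Finset.mem_singleton, not_or] at hx
    have ha : m * (x - a) ≠ 0 := mul_ne_zero hm0 (sub_ne_zero.2 hx.1)
    have hb : m * (x - b) ≠ 0 := mul_ne_zero hm0 (sub_ne_zero.2 hx.2)
    have hc₁ : c ≠ m * x + (c - m * a) := fun h => ha (by linear_combination -h)
    have hd₁ : d ≠ m * x + (c - m * a) := fun h => hb (by linear_combination -h + hm)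
    simp [Set.InjOn, hcd, hcd.symm, hc₁, hd₁, hc₁.symm, hd₁.symm]
  · rw [← Function.comp_apply (f := f), he, lineProd, Finset.prod_pair hab,
      Finset.prod_insert (by simp [hcd, hm0.symm]), Finset.prod_pair (by simp [hm0.symm])]
    simp only [Matrix.cons_val_zero, Matrix.cons_val_one]
    linear_combination (l * (x - a) * (x - b) * (y - c) * (y - d) * (x - a)) * hm

theorem IsThirdWord.spec (hq : 5 < Fintype.card F) {f : (Fin 2 → F) → F} (h : IsThirdWord f) :
    f ∈ code F 5 2 ∧ weight f = (Fintype.card F - 3) * (Fintype.card F - 2) := by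
  obtain ⟨T, h | h | h | h⟩ := h
  exacts [h.spec hq, h.spec hq, h.spec hq, h.spec hq]

end Converse

/-! ### The two smaller weights. -/

section ThirdWeight

variable {F : Type*} [Field F] [Fintype F] [DecidableEq F]

/-- Products of five lines in two parallel classes realize the weights `(q - r) (q - s)`,
`r + s = 5`. -/
theorem mem_weights_grid (hq : 5 < Fintype.card F) {r s : ℕ} (hrs : r + s = 5) :
    (Fintype.card F - r) * (Fintype.card F - s) ∈ weights (code F 5 2) := by
  obtain ⟨R, -, hR⟩ := Finset.exists_subset_card_eq
    (show r ≤ (Finset.univ : Finset F).card by rw [Finset.card_univ]; omega)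
  obtain ⟨S, -, hS⟩ := Finset.exists_subset_card_eq
    (show s ≤ (Finset.univ : Finset F).card by rw [Finset.card_univ]; omega)
  have hM : (S.image fun c => ((0 : F), c)).card = s := by
    rw [Finset.card_image_of_injective _ (Prod.mk_right_injective 0), hS]
  have hw := weight_lineProd_of_injOn (one_ne_zero (α := F)) (R := R)
    (M := S.image fun c => ((0 : F), c)) fun x _ => by simp [Set.InjOn]
  rw [hR, hM] at hw
  refine ⟨_, lineProd_mem_code hq 1 (by rw [hR, hM, hrs]), fun h => ?_, hw⟩
  rw [h] at hw
  have h0 : weight (0 : (Fin 2 → F) → F) = 0 := by simp [weight]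
  rw [h0, eq_comm, mul_eq_zero] at hw
  omega

theorem isThirdWeight (hq : 13 ≤ Fintype.card F) :
    IsThirdWeight (code F 5 2) ((Fintype.card F - 3) * (Fintype.card F - 2)) := by
  refine ⟨mem_weights_grid (by omega) rfl, ?_⟩
  have h5 := mem_weights_grid (F := F) (by omega) (r := 5) (s := 0) rfl
  have h4 := mem_weights_grid (F := F) (by omega) (r := 4) (s := 1) rfl
  rw [Nat.sub_zero] at h5
  obtain ⟨n, hn⟩ : ∃ n, Fintype.card F = n + 13 := ⟨_, (Nat.sub_add_cancel hq).symm⟩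
  have e5 : Fintype.card F - 5 = n + 8 := by omega
  have e4 : Fintype.card F - 4 = n + 9 := by omega
  have e3 : Fintype.card F - 3 = n + 10 := by omega
  have e2 : Fintype.card F - 2 = n + 11 := by omega
  have e1 : Fintype.card F - 1 = n + 12 := by omega
  have hset : {v | v ∈ weights (code F 5 2) ∧ v < (Fintype.card F - 3) * (Fintype.card F - 2)} =
      {(Fintype.card F - 5) * Fintype.card F, (Fintype.card F - 4) * (Fintype.card F - 1)} := by
    ext v
    constructor
    · rintro ⟨⟨f, hf, hf0, rfl⟩, hlt⟩
      rcases classification hq hf hf0 hlt.le with h | h | h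
      · exact Or.inl h
      · exact Or.inr h
      · exact absurd (h.spec (by omega)).2 hlt.ne
    · rintro (rfl | rfl)
      · refine ⟨h5, ?_⟩
        rw [e5, e3, e2, hn]
        nlinarith
      · refine ⟨h4, ?_⟩
        rw [e4, e3, e2, e1]
        nlinarith
  rw [hset, Set.ncard_pair]
  rw [e5, e4, e1, hn]
  intro h
  nlinarith

end ThirdWeight

end ReedMuller

theorem mainTheorem8 {F : Type*} [Field F] [Fintype F] (hq : 13 ≤ Fintype.card F) :
    ReedMuller.IsThirdWeight (ReedMuller.code F 5 2)
      ((Fintype.card F - 3) * (Fintype.card F - 2)) ∧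
    ∀ f : (Fin 2 → F) → F,
      (f ∈ ReedMuller.code F 5 2 ∧
          ReedMuller.weight f = (Fintype.card F - 3) * (Fintype.card F - 2)) ↔
        ∃ T : (Fin 2 → F) ≃ᵃ[F] (Fin 2 → F),
          ReedMuller.IsGridWord (f ∘ T) ∨ ReedMuller.IsPencilWord (f ∘ T) ∨
            ReedMuller.IsTripleParallelWord (f ∘ T) ∨ ReedMuller.IsDiagonalWord (f ∘ T) := by
  classical
  refine ⟨ReedMuller.isThirdWeight hq, fun f => ⟨?_, ReedMuller.IsThirdWord.spec (by omega)⟩⟩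
  rintro ⟨hf, hw⟩
  obtain ⟨n, hn⟩ : ∃ n, Fintype.card F = n + 13 := ⟨_, (Nat.sub_add_cancel hq).symm⟩
  have e5 : Fintype.card F - 5 = n + 8 := by omega
  have e4 : Fintype.card F - 4 = n + 9 := by omega
  have e3 : Fintype.card F - 3 = n + 10 := by omega
  have e2 : Fintype.card F - 2 = n + 11 := by omega
  have e1 : Fintype.card F - 1 = n + 12 := by omega
  have hf0 : f ≠ 0 := by
    rintro rfl
    have h0 : ReedMuller.weight (0 : (Fin 2 → F) → F) = 0 := by simp [ReedMuller.weight]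
    rw [h0, e3, e2] at hw
    nlinarith
  rcases ReedMuller.classification hq hf hf0 hw.le with h | h | h
  · exfalso
    rw [hw, e5, e3, e2, hn] at h
    nlinarith
  · exfalso
    rw [hw, e4, e3, e2, e1] at h
    nlinarith
  · exact h
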